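/- Conventions. All registers are finite-dimensional, $\log=\log_2$, and $U_m$ is uniform on $\{0,1\}^m$. The trace distance of operators is $\|\rho-\sigma\|_{\mathrm{tr}}=\tfrac12\operatorname{Tr}|\rho-\sigma|$; for distributions it is the statistical distance. For a random variable $X$, $H_{\min}(X)=\min_x\log(1/\Pr[X=x])$. For a state $\rho_{XE}$ with $X$ classical, $$H_{\min}(X|E)_\rho=\max\{\lambda\ge 0:\ \exists\text{ a density operator }\sigma_E\text{ with }2^{-\lambda}\,\mathrm{id}_X\otimes\sigma_E\ge\rho_{XE}\}.$$ Classical extractors. A function $\mathrm{2Ext}:\{0,1\}^{n_1}\times\{0,1\}^{n_2}\to\{0,1\}^m$ is an $(n_1,k_1,n_2,k_2,m,\varepsilon)$ two-source extractor if $\|\mathrm{2Ext}(X_1,X_2)-U_m\|_{\mathrm{tr}}\le\varepsilon$ for all independent $X_1\in\{0,1\}^{n_1}$, $X_2\in\{0,1\}^{n_2}$ with $H_{\min}(X_1)\ge k_1$ and $H_{\min}(X_2)\ge k_2$. It is $X_i$-strong ($i\in\{1,2\}$) if moreover $\|\mathrm{2Ext}(X_1,X_2)X_i-U_m\otimes X_i\|_{\mathrm{tr}}\le\varepsilon$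 for all such $X_1,X_2$. One-sided adversaries (OA). Let $X_1,X_2$ be independent. The adversary chooses $i^*\in\{1,2\}$ and prepares a quantum state $\rho_0$ on a register $A$, independent of $X_1,X_2$. An $X_{i^*}$-controlled quantum operation is applied: when $X_{i^*}=x$, a completely positive trace-preserving map $\Phi_x$ takes $A$ to a register $E$. The adversary then holds $E$, and $\rho=\rho_{X_1X_2E}$ is the resulting state. The entropies of the sources are $H_{\min}(X_{i^*}|E)_\rho$ for the source $i^*$ and $H_{\min}(X_j)$ for the source $j\ne i^*$. The function $\mathrm{2Ext}$ is an OA-secure $(n_1,k_1,n_2,k_2,m,\varepsilon)$ two-source extractor if $\|\rho_{\mathrm{2Ext}(X_1,X_2)E}-U_m\otimes\rho_E\|_{\mathrm{tr}}\le\varepsilon$ for every such $\rho$ in which the entropies of $X_1$ and $X_2$ are at least $k_1$ and $k_2$. It is $X_i$-strong if moreover $\|\rho_{\mathrm{2Ext}(X_1,X_2)X_iE}-U_m\otimes\rho_{X_iE}\|_{\mathrm{tr}}\le\varepsilon$ for every such $\rho$. Theorem. Let $\varepsilon>0$, let $k_1,k_2$ be real numbers, and let $\mathrm{2Ext}:\{0,1\}^{n_1}\times\{0,1\}^{n_2}\to\{0,1\}^m$.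 1. If $\mathrm{2Ext}$ is a classical $(n_1,k_1,n_2,k_2,m,\varepsilon)$ $X_1$-strong two-source extractor, then it is an OA-secure $(n_1,k_1,n_2,k_2+\log(1/\varepsilon),m,2^m\sqrt{\varepsilon})$ $X_1$-strong two-source extractor. 2. If $\mathrm{2Ext}$ is a classical $(n_1,k_1,n_2,k_2,m,\varepsilon)$ $X_2$-strong two-source extractor, then it is an OA-secure $(n_1,k_1+\log(1/\varepsilon),n_2,k_2,m,2^m\sqrt{\varepsilon})$ $X_2$-strong two-source extractor. 3. Consequently, if $\mathrm{2Ext}$ is a classical $(n_1,k_1,n_2,k_2,m,\varepsilon)$ two-source extractor that is both $X_1$-strong and $X_2$-strong, then it is an OA-secure $(n_1,k_1+\log(1/\varepsilon),n_2,k_2+\log(1/\varepsilon),m,2^m\sqrt{\varepsilon})$ two-source extractor that is both $X_1$-strong and $X_2$-strong. -/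

import Mathlib

noncomputable section

namespace QExt

open scoped Kronecker ComplexOrder

/-- Bit strings of length `n`. -/
abbrev Bits (n : ℕ) : Type := Fin n → Bool

section Classical

variable {X Y W : Type} [Fintype X] [Fintype Y] [DecidableEq Y] [DecidableEq W]

/-- Min-entropy `min_x log₂ (1 / p x)` of a distribution `p`; values of probability zero, for which
`log₂ (1 / 0) = ∞`, do not contribute to the minimum. -/
def minEntropy (p : X → ℝ) : ℝ :=
  ⨅ x : {x : X // p x ≠ 0}, Real.logb 2 (1 / p x.1)

/-- Statistical distance of two distributions. -/
def statDist (p q : X → ℝ) : ℝ :=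
  (1 / 2) * ∑ x, |p x - q x|

/-- The joint law of two independent random variables with laws `p₁` and `p₂`. -/
def prodLaw (p₁ : X → ℝ) (p₂ : Y → ℝ) : X × Y → ℝ :=
  fun x => p₁ x.1 * p₂ x.2

/-- The law of `f(X)`, when `X` has law `p`. -/
def pushLaw (f : X → Y) (p : X → ℝ) : Y → ℝ :=
  fun y => ∑ x, if f x = y then p x else 0

/-- Statistical distance between `(Ext(X₁,X₂), g(X₁,X₂))` and `(U_m, g(X₁,X₂))`, with `U_m` uniform
on `m` bits and independent of `g(X₁,X₂)`, when `(X₁,X₂)` has law `p`. -/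
def classicalDist {m : ℕ} [Fintype W] (ext : X → Bits m) (g : X → W) (p : X → ℝ) : ℝ :=
  statDist (pushLaw (fun x => (ext x, g x)) p)
    (prodLaw (fun _ : Bits m => (1 / 2 : ℝ) ^ m) (pushLaw g p))

end Classical

section Quantum

variable {X Y W A E : Type} [Fintype X] [DecidableEq X] [Fintype Y] [DecidableEq Y]
  [Fintype W] [DecidableEq W] [Fintype A] [DecidableEq A] [Fintype E] [DecidableEq E]

/-- Density operators. -/
def IsDensity (ρ : Matrix A A ℂ) : Prop :=
  ρ.PosSemidef ∧ ρ.trace = 1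

/-- The trace norm: the sum of the singular values, i.e. of the square roots of the eigenvalues
of `Mᴴ * M`. -/
def traceNorm (M : Matrix A A ℂ) : ℝ :=
  ∑ i, √((Matrix.isHermitian_conjTranspose_mul_self M).eigenvalues i)

/-- The trace distance. -/
def traceDist (ρ σ : Matrix A A ℂ) : ℝ :=
  (1 / 2) * traceNorm (ρ - σ)

/-- Admissible super-operators (quantum operations): completely positive, trace-preserving linear
maps. Complete positivity says that `Φ ⊗ id` on `A ⊗ ℂʳ` preserves positive semidefiniteness, for
every `r`. -/
def IsAdmissible (Φ : Matrix A A ℂ →ₗ[ℂ] Matrix E E ℂ) : Prop :=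
  (∀ (r : ℕ) (M : Matrix (A × Fin r) (A × Fin r) ℂ), M.PosSemidef →
    (Matrix.of fun (i j : E × Fin r) =>
      Φ (Matrix.of fun a b => M (a, i.2) (b, j.2)) i.1 j.1).PosSemidef) ∧
  ∀ M : Matrix A A ℂ, (Φ M).trace = M.trace

/-- The operator `⟨x| M |x⟩` on `E`, for an operator `M` on `X ⊗ E`. -/
def block (M : Matrix (X × E) (X × E) ℂ) (x : X) : Matrix E E ℂ :=
  Matrix.of fun e e' => M (x, e) (x, e')

/-- The `X`-controlled operation `∑ x, |x⟩⟨x| ⊗ Φ x (⟨x| · |x⟩)`. -/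
def controlled (Φ : X → (Matrix A A ℂ →ₗ[ℂ] Matrix E E ℂ)) (M : Matrix (X × A) (X × A) ℂ) :
    Matrix (X × E) (X × E) ℂ :=
  ∑ x, Matrix.single x x (1 : ℂ) ⊗ₖ Φ x (block M x)

/-- The state of a classical register with law `p`. -/
def classicalState (p : X → ℝ) : Matrix X X ℂ :=
  Matrix.diagonal fun x => (p x : ℂ)

/-- Replace the classical register `X` by the value `f(X)`: the operation
`M ↦ ∑ x, |f x⟩⟨f x| ⊗ ⟨x| M |x⟩`. For a projection `f` this is a partial trace. -/
def applyFun (f : X → Y) (M : Matrix (X × E) (X × E) ℂ) : Matrix (Y × E) (Y × E) ℂ :=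
  ∑ x, Matrix.single (f x) (f x) (1 : ℂ) ⊗ₖ block M x

/-- The conditional min-entropy `H_min(X|E)_ρ`: the largest `lam ≥ 0` such that
`2^(-lam) id_X ⊗ σ_E ≥ ρ_XE` for some density operator `σ_E`. -/
def condMinEntropy (ρ : Matrix (X × E) (X × E) ℂ) : ℝ :=
  sSup {lam : ℝ | 0 ≤ lam ∧ ∃ σ : Matrix E E ℂ, IsDensity σ ∧
    (((2 : ℝ) ^ (-lam)) • ((1 : Matrix X X ℂ) ⊗ₖ σ) - ρ).PosSemidef}

/-- Trace distance between `ρ_{Ext(X) g(X) E}` and `U_m ⊗ ρ_{g(X) E}`, where `ρ = ρ_{XE}`. -/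
def quantumDist {m : ℕ} (ext : X → Bits m) (g : X → W) (ρ : Matrix (X × E) (X × E) ℂ) : ℝ :=
  traceDist (applyFun (fun x => (ext x, g x)) ρ)
    (Matrix.reindex (Equiv.prodAssoc (Bits m) W E).symm (Equiv.prodAssoc (Bits m) W E).symm
      (classicalState (fun _ : Bits m => (1 / 2 : ℝ) ^ m) ⊗ₖ applyFun g ρ))

end Quantum

variable {n₁ n₂ m : ℕ}

/-- The error of `ext` on all pairs of independent sources with min-entropies at least `k₁`, `k₂`
is at most `ε`, even given the value `g(X₁,X₂)`. -/
def ClassicalSecure {W : Type} [Fintype W] [DecidableEq W] (ext : Bits n₁ × Bits n₂ → Bits m)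
    (g : Bits n₁ × Bits n₂ → W) (k₁ k₂ ε : ℝ) : Prop :=
  ∀ p₁ ∈ stdSimplex ℝ (Bits n₁), ∀ p₂ ∈ stdSimplex ℝ (Bits n₂),
    k₁ ≤ minEntropy p₁ → k₂ ≤ minEntropy p₂ →
      classicalDist ext g (prodLaw p₁ p₂) ≤ ε

/-- The state `ρ_{X₁X₂E}` of two independent sources and the side information, when the adversary
prepares `ρ₀` on a register `A` and the operation `Φ x`, with `x` the value of `(X₁,X₂)`,
is applied to `A`. -/
def sideInfoState {dA dE : ℕ} (p₁ : Bits n₁ → ℝ) (p₂ : Bits n₂ → ℝ)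
    (ρ₀ : Matrix (Fin dA) (Fin dA) ℂ)
    (Φ : Bits n₁ × Bits n₂ → (Matrix (Fin dA) (Fin dA) ℂ →ₗ[ℂ] Matrix (Fin dE) (Fin dE) ℂ)) :
    Matrix ((Bits n₁ × Bits n₂) × Fin dE) ((Bits n₁ × Bits n₂) × Fin dE) ℂ :=
  controlled Φ (classicalState (prodLaw p₁ p₂) ⊗ₖ ρ₀)

/-- The error of `ext` against one-sided adversaries is at most `ε`, even given the value
`g(X₁,X₂)`. The adversary chooses the source that leaks. In the first part it is `X₁`: the leaking
operation is controlled by `X₁`, and the entropies are `H_min(X₁|E)` and `H_min(X₂)`. In the second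
part it is `X₂`. -/
def OASecure {W : Type} [Fintype W] [DecidableEq W] (ext : Bits n₁ × Bits n₂ → Bits m)
    (g : Bits n₁ × Bits n₂ → W) (k₁ k₂ ε : ℝ) : Prop :=
  (∀ p₁ ∈ stdSimplex ℝ (Bits n₁), ∀ p₂ ∈ stdSimplex ℝ (Bits n₂),
    ∀ (dA dE : ℕ) (ρ₀ : Matrix (Fin dA) (Fin dA) ℂ)
      (Φ : Bits n₁ → (Matrix (Fin dA) (Fin dA) ℂ →ₗ[ℂ] Matrix (Fin dE) (Fin dE) ℂ)),
      IsDensity ρ₀ → (∀ x, IsAdmissible (Φ x)) →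
      k₁ ≤ condMinEntropy (applyFun Prod.fst (sideInfoState p₁ p₂ ρ₀ fun x => Φ x.1)) →
      k₂ ≤ minEntropy p₂ →
        quantumDist ext g (sideInfoState p₁ p₂ ρ₀ fun x => Φ x.1) ≤ ε) ∧
  (∀ p₁ ∈ stdSimplex ℝ (Bits n₁), ∀ p₂ ∈ stdSimplex ℝ (Bits n₂),
    ∀ (dA dE : ℕ) (ρ₀ : Matrix (Fin dA) (Fin dA) ℂ)
      (Φ : Bits n₂ → (Matrix (Fin dA) (Fin dA) ℂ →ₗ[ℂ] Matrix (Fin dE) (Fin dE) ℂ)),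
      IsDensity ρ₀ → (∀ x, IsAdmissible (Φ x)) →
      k₁ ≤ minEntropy p₁ →
      k₂ ≤ condMinEntropy (applyFun Prod.snd (sideInfoState p₁ p₂ ρ₀ fun x => Φ x.2)) →
        quantumDist ext g (sideInfoState p₁ p₂ ρ₀ fun x => Φ x.2) ≤ ε)

/-- Classical `(n₁, k₁, n₂, k₂, m, ε)` two-source extractors. -/
def IsTwoSourceExtractor (ext : Bits n₁ × Bits n₂ → Bits m) (k₁ k₂ ε : ℝ) : Prop :=
  ClassicalSecure ext (fun _ => ()) k₁ k₂ ε

/-- Classical `X₁`-strong two-source extractors. -/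
def IsX1StrongTwoSourceExtractor (ext : Bits n₁ × Bits n₂ → Bits m) (k₁ k₂ ε : ℝ) : Prop :=
  IsTwoSourceExtractor ext k₁ k₂ ε ∧ ClassicalSecure ext Prod.fst k₁ k₂ ε

/-- Classical `X₂`-strong two-source extractors. -/
def IsX2StrongTwoSourceExtractor (ext : Bits n₁ × Bits n₂ → Bits m) (k₁ k₂ ε : ℝ) : Prop :=
  IsTwoSourceExtractor ext k₁ k₂ ε ∧ ClassicalSecure ext Prod.snd k₁ k₂ ε

/-- OA-secure `(n₁, k₁, n₂, k₂, m, ε)` two-source extractors. -/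
def IsOATwoSourceExtractor (ext : Bits n₁ × Bits n₂ → Bits m) (k₁ k₂ ε : ℝ) : Prop :=
  OASecure ext (fun _ => ()) k₁ k₂ ε

/-- OA-secure `X₁`-strong two-source extractors. -/
def IsOAX1StrongTwoSourceExtractor (ext : Bits n₁ × Bits n₂ → Bits m) (k₁ k₂ ε : ℝ) : Prop :=
  IsOATwoSourceExtractor ext k₁ k₂ ε ∧ OASecure ext Prod.fst k₁ k₂ ε

/-- OA-secure `X₂`-strong two-source extractors. -/
def IsOAX2StrongTwoSourceExtractor (ext : Bits n₁ × Bits n₂ → Bits m) (k₁ k₂ ε : ℝ) : Prop :=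
  IsOATwoSourceExtractor ext k₁ k₂ ε ∧ OASecure ext Prod.snd k₁ k₂ ε

end QExt

end

/-! The trace distance is half the best advantage of a Hermitian contraction as a test
(`quantumDist_le`), so the task is to bound the correlation of tests `T y z` with signed mixtures `D
y z` of the adversary's conditional states. Here `y` is the strong source, which acts as a visible
seed, `x` is the other source and `z` the output.

If the seed leaks, the adversary's state given `y` does not depend on `x`. It factors out of `D y
z`, and the classical strong error `ε` bounds the advantage (`sum_re_trace_le_of_seed_leak`).

If `x` leaks, a weighted Cauchy-Schwarz inequality bounds `Tr(T D)` by the trace of a regularised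
state `S * S` of `E` and the quadratic form `Tr(D S⁻¹ D S⁻¹)`. Expanding one factor `D` over `x'`
exposes the pretty good measurement `S⁻¹ r_x' S⁻¹`: the form is at most the distinguishing advantage
of an observer who measures `E` and keeps only the classical guess `x'`. Classical side information
is harmless up to a Markov argument: the guesses after which `x` has min-entropy below `k` have
total weight at most `ε`, because the guessing probability is at most `ε * 2 ^ (-k)`. This is what
the extra `log (1/ε)` of entropy pays for. Averaged over seeds and summed over outputs, the form is
at most `4ε`. Balancing it against the trace term, which is paid once per output, gives error `√(2 ^
m * ε)`, slightly better than claimed (`sum_re_trace_le_of_guessing`). -/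

namespace QExt

open scoped Kronecker ComplexOrder MatrixOrder

/-! ### Contractions, square roots and a weighted Cauchy-Schwarz inequality -/

section LinearAlgebra

set_option linter.unusedSectionVars false

variable {A : Type*} [Fintype A] [DecidableEq A]

/-- Hermitian contractions: the matrices `T` with `-1 ≤ T ≤ 1`. -/
def IsContraction (T : Matrix A A ℂ) : Prop :=
  (1 - T).PosSemidef ∧ (1 + T).PosSemidef

lemma IsContraction.isHermitian {T : Matrix A A ℂ} (hT : IsContraction T) : T.IsHermitian := by
  have h := Matrix.isHermitian_one.sub hT.1.1
  rwa [sub_sub_cancel] at h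

lemma IsContraction.submatrix {B : Type*} [DecidableEq B] {T : Matrix A A ℂ} (hT : IsContraction T)
    {f : B → A} (hf : Function.Injective f) : IsContraction (T.submatrix f f) := by
  have h₁ := hT.1.submatrix f
  have h₂ := hT.2.submatrix f
  rw [Matrix.submatrix_sub, Pi.sub_apply, Pi.sub_apply, Matrix.submatrix_one _ hf] at h₁
  rw [Matrix.submatrix_add, Pi.add_apply, Pi.add_apply, Matrix.submatrix_one _ hf] at h₂
  exact ⟨h₁, h₂⟩

/-- Everything commutes, so `(1-T)(1+T)(1-T) + (1+T)(1-T)(1+T) = 2(1-T²)`, and each summand is a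
congruence of a positive matrix. -/
lemma IsContraction.one_sub_mul_self {T : Matrix A A ℂ} (hT : IsContraction T) :
    (1 - T * T).PosSemidef := by
  have h₁ := hT.2.mul_mul_conjTranspose_same (1 - T)
  have h₂ := hT.1.mul_mul_conjTranspose_same (1 + T)
  rw [hT.1.1.eq] at h₁
  rw [hT.2.1.eq] at h₂
  have h := (h₁.add h₂).smul (show (0 : ℝ) ≤ 1 / 2 by norm_num)
  convert h using 1
  have : (1 - T) * (1 + T) * (1 - T) + (1 + T) * (1 - T) * (1 + T) = (2 : ℝ) • (1 - T * T) := by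
    rw [two_smul]; noncomm_ring
  rw [this, smul_smul]
  norm_num

lemma exists_posSemidef_mul_self {M : Matrix A A ℂ} (hM : M.PosSemidef) :
    ∃ S : Matrix A A ℂ, S.PosSemidef ∧ S * S = M :=
  ⟨CFC.sqrt M, Matrix.nonneg_iff_posSemidef.1 (CFC.sqrt_nonneg M),
    CFC.sqrt_mul_sqrt_self M (Matrix.nonneg_iff_posSemidef.2 hM)⟩

lemma exists_posDef_mul_self {M : Matrix A A ℂ} (hM : M.PosDef) :
    ∃ S : Matrix A A ℂ, S.PosDef ∧ S * S = M := by
  obtain ⟨S, hS, h⟩ := exists_posSemidef_mul_self hM.posSemidef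
  refine ⟨S, hS.posDef_iff_isUnit.2 ?_, h⟩
  exact isUnit_of_mul_isUnit_left (h ▸ hM.isUnit)

lemma re_trace_nonneg {M : Matrix A A ℂ} (hM : M.PosSemidef) : 0 ≤ M.trace.re :=
  (Complex.nonneg_iff.1 hM.trace_nonneg).1

lemma re_trace_mul_nonneg {M N : Matrix A A ℂ} (hM : M.PosSemidef) (hN : N.PosSemidef) :
    0 ≤ (M * N).trace.re := by
  obtain ⟨S, hS, rfl⟩ := exists_posSemidef_mul_self hM
  have h := hN.mul_mul_conjTranspose_same S
  rw [hS.1.eq] at h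
  rw [Matrix.mul_assoc, Matrix.trace_mul_comm]
  exact re_trace_nonneg h

lemma re_trace_mul_le_of_sub {M N K : Matrix A A ℂ} (h : (N - M).PosSemidef) (hK : K.PosSemidef) :
    (M * K).trace.re ≤ (N * K).trace.re := by
  have := re_trace_mul_nonneg h hK
  rw [Matrix.sub_mul, Matrix.trace_sub, Complex.sub_re] at this
  linarith

lemma IsContraction.abs_re_trace_mul_le {T M : Matrix A A ℂ} (hT : IsContraction T)
    (hM : M.PosSemidef) : |(T * M).trace.re| ≤ M.trace.re := by
  have h₁ := re_trace_mul_nonneg hT.1 hM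
  have h₂ := re_trace_mul_nonneg hT.2 hM
  rw [Matrix.sub_mul, Matrix.trace_sub, Complex.sub_re, Matrix.one_mul] at h₁
  rw [Matrix.add_mul, Matrix.trace_add, Complex.add_re, Matrix.one_mul] at h₂
  rw [abs_le]
  constructor <;> linarith

lemma re_trace_mul_self_nonneg {M : Matrix A A ℂ} (hM : M.IsHermitian) :
    0 ≤ (M * M).trace.re := by
  have h := Matrix.posSemidef_conjTranspose_mul_self M
  rw [hM.eq] at h
  exact re_trace_nonneg h

lemma isHermitian_mul_mul_same {R M : Matrix A A ℂ} (hR : R.IsHermitian) (hM : M.IsHermitian) :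
    (R * M * R).IsHermitian := by
  have := Matrix.isHermitian_mul_mul_conjTranspose R hM
  rwa [hR.eq] at this

/-- Nonnegativity of the squared Hilbert-Schmidt norm of the commutator `S T - T S` gives `Tr(TSTS)
≤ Tr(T²S²)`; then `T² ≤ 1`. -/
lemma IsContraction.re_trace_conj_le {T S : Matrix A A ℂ} (hT : IsContraction T)
    (hS : S.IsHermitian) : (T * S * T * S).trace.re ≤ (S * S).trace.re := by
  have hTH := hT.isHermitian
  have h₁ : 0 ≤ ((S * T - T * S).conjTranspose * (S * T - T * S)).trace.re :=
    re_trace_nonneg (Matrix.posSemidef_conjTranspose_mul_self _)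
  have h₂ : (T * T * (S * S)).trace.re ≤ (1 * (S * S)).trace.re := by
    refine re_trace_mul_le_of_sub hT.one_sub_mul_self ?_
    have h := Matrix.posSemidef_conjTranspose_mul_self S
    rwa [hS.eq] at h
  rw [Matrix.one_mul] at h₂
  have e : (S * T - T * S).conjTranspose * (S * T - T * S)
      = T * S * S * T - T * S * T * S - S * T * S * T + S * T * T * S := by
    rw [Matrix.conjTranspose_sub, Matrix.conjTranspose_mul, Matrix.conjTranspose_mul, hTH.eq, hS.eq]
    noncomm_ring
  have e₁ : (T * S * S * T).trace = (T * T * (S * S)).trace := by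
    rw [Matrix.trace_mul_comm]; congr 1; noncomm_ring
  have e₂ : (S * T * S * T).trace = (T * S * T * S).trace := by
    rw [Matrix.trace_mul_comm]; congr 1; noncomm_ring
  have e₃ : (S * T * T * S).trace = (T * T * (S * S)).trace := by
    rw [Matrix.trace_mul_comm, Matrix.trace_mul_comm (T * T)]; congr 1; noncomm_ring
  rw [e, Matrix.trace_add, Matrix.trace_sub, Matrix.trace_sub, e₁, e₂, e₃] at h₁
  simp only [Complex.add_re, Complex.sub_re] at h₁
  linarith

/-- Weighted Cauchy-Schwarz inequality for the pairing of a contraction with a Hermitian matrix. -/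
lemma IsContraction.two_mul_re_trace_mul_le {T D S : Matrix A A ℂ} (hT : IsContraction T)
    (hD : D.IsHermitian) (hS : S.PosDef) {t : ℝ} (ht : 0 < t) :
    2 * (T * D).trace.re ≤ t * (S * S).trace.re + t⁻¹ * (D * S⁻¹ * D * S⁻¹).trace.re := by
  -- With `R = √S`, put `K = R T R` and `L = R⁻¹ D R⁻¹`. Then `Tr(K L) = Tr(T D)`, and the claim
  -- comes from expanding `Tr((√t K - L/√t)²) ≥ 0`.
  obtain ⟨R, hR, rfl⟩ := exists_posDef_mul_self hS
  have hdet : IsUnit R.det := (Matrix.isUnit_iff_isUnit_det R).1 hR.isUnit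
  have hRi : R * R⁻¹ = 1 := Matrix.mul_nonsing_inv R hdet
  have hiR : R⁻¹ * R = 1 := Matrix.nonsing_inv_mul R hdet
  have hinv : (R * R)⁻¹ = R⁻¹ * R⁻¹ := Matrix.mul_inv_rev R R
  have hKH := isHermitian_mul_mul_same hR.1 hT.isHermitian
  have hLH := isHermitian_mul_mul_same hR.inv.1 hD
  have hKK : (R * T * R * (R * T * R)).trace = (T * (R * R) * T * (R * R)).trace := by
    rw [Matrix.mul_assoc R T R, Matrix.mul_assoc R, Matrix.trace_mul_comm]
    congr 1; noncomm_ring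
  have hLL : (R⁻¹ * D * R⁻¹ * (R⁻¹ * D * R⁻¹)).trace = (D * (R * R)⁻¹ * D * (R * R)⁻¹).trace := by
    rw [hinv, Matrix.mul_assoc R⁻¹ D, Matrix.mul_assoc R⁻¹, Matrix.trace_mul_comm]
    congr 1; noncomm_ring
  have hKL : (R * T * R * (R⁻¹ * D * R⁻¹)).trace = (T * D).trace := by
    have : R * T * R * (R⁻¹ * D * R⁻¹) = R * (T * (R * R⁻¹) * D * R⁻¹) := by noncomm_ring
    rw [this, hRi, Matrix.trace_mul_comm]
    have : T * 1 * D * R⁻¹ * R = T * D * (R⁻¹ * R) := by noncomm_ring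
    rw [this, hiR, Matrix.mul_one]
  have hLK : (R⁻¹ * D * R⁻¹ * (R * T * R)).trace = (T * D).trace := by
    rw [Matrix.trace_mul_comm, hKL]
  have h₁ := hT.re_trace_conj_le hS.1
  generalize R * T * R = K at *
  generalize R⁻¹ * D * R⁻¹ = L at *
  have h₂ := re_trace_mul_self_nonneg
    (((hKH.smul (IsSelfAdjoint.all (√t))).sub (hLH.smul (IsSelfAdjoint.all (√t)⁻¹))))
  have hs : √t * √t = t := Real.mul_self_sqrt ht.le
  have hs' : √t * (√t)⁻¹ = 1 := mul_inv_cancel₀ (Real.sqrt_pos.2 ht).ne'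
  have e : (√t • K - (√t)⁻¹ • L) * (√t • K - (√t)⁻¹ • L)
      = t • (K * K) - K * L - L * K + t⁻¹ • (L * L) := by
    simp only [Matrix.sub_mul, Matrix.mul_sub, Matrix.smul_mul, Matrix.mul_smul, smul_sub, smul_smul]
    rw [hs, hs', mul_comm (√t)⁻¹, hs', ← mul_inv, hs, one_smul, one_smul]
    abel
  rw [e, Matrix.trace_add, Matrix.trace_sub, Matrix.trace_sub, Matrix.trace_smul,
    Matrix.trace_smul, hKK, hLL, hKL, hLK] at h₂
  simp only [Complex.add_re, Complex.sub_re, Complex.smul_re, smul_eq_mul] at h₂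
  have := mul_le_mul_of_nonneg_left h₁ ht.le
  linarith

end LinearAlgebra

/-! ### Duality for the trace norm -/

section TraceNorm

variable {A : Type} [Fintype A] [DecidableEq A]

/-- The trace norm of a Hermitian matrix is attained on a Hermitian contraction. -/
lemma exists_traceNorm_eq {M : Matrix A A ℂ} (hM : M.IsHermitian) :
    ∃ T : Matrix A A ℂ, IsContraction T ∧ traceNorm M = (T * M).trace.re := by
  set U : Matrix A A ℂ := (hM.eigenvectorUnitary : Matrix A A ℂ) with hU
  set d := hM.eigenvalues with hd
  have hUU : star U * U = 1 := Unitary.coe_star_mul_self hM.eigenvectorUnitary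
  have hUU' : U * star U = 1 := Unitary.coe_mul_star_self hM.eigenvectorUnitary
  have hspec : M = U * Matrix.diagonal (fun i => (d i : ℂ)) * star U := by
    conv_lhs => rw [hM.spectral_theorem, Unitary.conjStarAlgAut_apply]
    rfl
  have hmul : ∀ a b : A → ℂ, U * Matrix.diagonal a * star U * (U * Matrix.diagonal b * star U)
      = U * Matrix.diagonal (fun i => a i * b i) * star U := by
    intro a b
    rw [← Matrix.diagonal_mul_diagonal]
    calc _ = U * Matrix.diagonal a * (star U * U) * Matrix.diagonal b * star U := by noncomm_ring
      _ = _ := by rw [hUU, Matrix.mul_one]; noncomm_ring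
  have htr : ∀ a : A → ℂ, (U * Matrix.diagonal a * star U).trace = ∑ i, a i := by
    intro a
    rw [Matrix.mul_assoc, Matrix.trace_mul_comm, Matrix.mul_assoc, hUU, Matrix.mul_one,
      Matrix.trace_diagonal]
  have hpsd : ∀ a : A → ℂ, 0 ≤ a → (U * Matrix.diagonal a * star U).PosSemidef := fun a ha =>
    (Matrix.PosSemidef.diagonal ha).mul_mul_conjTranspose_same U
  have hone : (1 : Matrix A A ℂ) = U * Matrix.diagonal (fun _ => 1) * star U := by
    rw [Matrix.diagonal_one, Matrix.mul_one, hUU']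
  -- The optimal test is the sign of `M`, taken in its eigenbasis.
  set s : A → ℂ := fun i => ((SignType.sign (d i) : ℝ) : ℂ) with hs
  have hsign : ∀ x : ℝ, -1 ≤ (SignType.sign x : ℝ) ∧ (SignType.sign x : ℝ) ≤ 1 := by
    intro x
    rcases lt_trichotomy x 0 with h | h | h <;> simp [h]
  refine ⟨U * Matrix.diagonal s * star U, ⟨?_, ?_⟩, ?_⟩
  · have : 1 - U * Matrix.diagonal s * star U
        = U * Matrix.diagonal (fun i => 1 - s i) * star U := by
      rw [← Matrix.diagonal_sub, Matrix.mul_sub, Matrix.sub_mul, ← hone]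
    rw [this]
    refine hpsd _ fun i => ?_
    have := (hsign (d i)).2
    simp only [hs, Pi.zero_apply]
    exact_mod_cast sub_nonneg.2 this
  · have : 1 + U * Matrix.diagonal s * star U
        = U * Matrix.diagonal (fun i => 1 + s i) * star U := by
      rw [← Matrix.diagonal_add, Matrix.mul_add, Matrix.add_mul, ← hone]
    rw [this]
    refine hpsd _ fun i => ?_
    have := (hsign (d i)).1
    simp only [hs, Pi.zero_apply]
    have h : (0 : ℝ) ≤ 1 + (SignType.sign (d i) : ℝ) := by linarith
    exact_mod_cast h
  -- The eigenvalues of `Mᴴ * M` in `traceNorm` are indexed independently of those of `M`, so they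
  -- are matched as multisets of roots of the characteristic polynomial.
  · have hroots : (M.conjTranspose * M).charpoly.roots
        = Multiset.map (fun i => ((d i * d i : ℝ) : ℂ)) Finset.univ.val := by
      have : M.conjTranspose * M
          = U * Matrix.diagonal (fun i => ((d i * d i : ℝ) : ℂ)) * star U := by
        rw [hM.eq]
        conv_lhs => rw [hspec]
        rw [hmul]
        simp
      rw [this, Matrix.charpoly_mul_comm, ← Matrix.mul_assoc, hUU, Matrix.one_mul,
        Matrix.charpoly_diagonal, ← Polynomial.roots_multiset_prod_X_sub_C
          (Multiset.map (fun i => ((d i * d i : ℝ) : ℂ)) Finset.univ.val), Multiset.map_map]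
      rfl
    rw [(Matrix.isHermitian_conjTranspose_mul_self M).roots_charpoly_eq_eigenvalues] at hroots
    have h := congrArg (fun m => (m.map fun z : ℂ => √z.re).sum) hroots
    simp only [Multiset.map_map, Function.comp_def] at h
    have h' : traceNorm M = ∑ i, √(d i * d i) := by
      simpa [traceNorm] using h
    conv_rhs => rw [hspec]
    rw [h', hmul, htr, Complex.re_sum]
    refine Finset.sum_congr rfl fun i _ => ?_
    rw [Real.sqrt_mul_self_eq_abs, ← sign_mul_self]
    simp [hs]

end TraceNorm

/-! ### Classical side information -/

section Guessing

variable {X Y Z : Type*} [Fintype X] [Fintype Y] [Fintype Z]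

/-- A bound on `∑ y, ∑ z, p y * |∑ x, c y z x * q x|` for all flat enough distributions `q` extends
to the joint laws of `X` and a guess, up to the weight of the guesses on which the conditional
distribution is not flat. -/
lemma sum_abs_le_of_guessing (p : Y → ℝ) (c : Y → Z → X → ℝ) {κ η γ : ℝ} (hκ : 0 < κ) (hη : 0 ≤ η)
    (hγ : 0 ≤ γ) (hp : ∀ y, 0 ≤ p y) (hp1 : ∑ y, p y = 1) (hc : ∀ y x, ∑ z, |c y z x| ≤ 2)
    (hflat : ∀ q ∈ stdSimplex ℝ X, (∀ x, q x ≤ κ) → ∑ y, ∑ z, p y * |∑ x, c y z x * q x| ≤ η)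
    {G : Type*} [Fintype G] (P : X → G → ℝ) (hP : ∀ x g, 0 ≤ P x g) (hP1 : ∑ g, ∑ x, P x g ≤ 1)
    (hguess : ∀ f : G → X, ∑ g, P (f g) g ≤ γ * κ) :
    ∑ g, ∑ y, ∑ z, p y * |∑ x, c y z x * P x g| ≤ η + 2 * γ := by
  classical
  set w : G → ℝ := fun g => ∑ x, P x g with hw
  have hw0 : ∀ g, 0 ≤ w g := fun g => Finset.sum_nonneg fun x _ => hP x g
  have htriv : ∀ g, ∑ y, ∑ z, p y * |∑ x, c y z x * P x g| ≤ 2 * w g := by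
    intro g
    calc ∑ y, ∑ z, p y * |∑ x, c y z x * P x g|
        ≤ ∑ y, ∑ z, p y * ∑ x, |c y z x| * P x g := by
          gcongr with y _ z _
          · exact hp y
          · refine (Finset.abs_sum_le_sum_abs _ _).trans (Finset.sum_le_sum fun x _ => ?_)
            rw [abs_mul, abs_of_nonneg (hP x g)]
      _ = ∑ y, p y * ∑ x, (∑ z, |c y z x|) * P x g := by
          refine Finset.sum_congr rfl fun y _ => ?_
          rw [← Finset.mul_sum, Finset.sum_comm]
          simp only [Finset.sum_mul]
      _ ≤ ∑ y, p y * ∑ x, 2 * P x g := by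
          gcongr with y _ x _
          · exact hp y
          · exact hP x g
          · exact hc y x
      _ = 2 * w g := by rw [← Finset.sum_mul, hp1, one_mul, ← Finset.mul_sum]
  have hgood : ∀ g, (∀ x, P x g ≤ κ * w g) →
      ∑ y, ∑ z, p y * |∑ x, c y z x * P x g| ≤ η * w g := by
    intro g hg
    rcases (hw0 g).eq_or_lt with h0 | h0
    -- A guess of weight zero cannot be conditioned on, but contributes nothing.
    · simpa [← h0] using htriv g
    · have := hflat (fun x => P x g / w g)
        ⟨fun x => div_nonneg (hP x g) h0.le, by rw [← Finset.sum_div]; exact div_self h0.ne'⟩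
        (fun x => (div_le_iff₀ h0).2 (hg x))
      calc ∑ y, ∑ z, p y * |∑ x, c y z x * P x g|
          = (∑ y, ∑ z, p y * |∑ x, c y z x * (P x g / w g)|) * w g := by
            simp only [← mul_div_assoc, ← Finset.sum_div, abs_div, abs_of_pos h0]
            rw [div_mul_cancel₀ _ h0.ne']
        _ ≤ η * w g := mul_le_mul_of_nonneg_right this h0.le
  rcases isEmpty_or_nonempty X with hX | hX
  · simp only [Finset.univ_eq_empty, Finset.sum_empty, abs_zero, mul_zero, Finset.sum_const_zero]
    positivity
  -- After a non-flat guess `g`, `f g` is a value of conditional probability above `κ`. Hence the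
  -- weight of such guesses is at most `κ⁻¹` times the success probability of `f`.
  have hex : ∀ g, ∃ x, ¬ (∀ x, P x g ≤ κ * w g) → κ * w g ≤ P x g := by
    intro g
    by_cases h : ∀ x, P x g ≤ κ * w g
    · exact ⟨Classical.arbitrary X, fun h' => absurd h h'⟩
    · push Not at h
      obtain ⟨x, hx⟩ := h
      exact ⟨x, fun _ => hx.le⟩
  choose f hf using hex
  have hbad : ∀ g, ∑ y, ∑ z, p y * |∑ x, c y z x * P x g| ≤ η * w g + 2 * (κ⁻¹ * P (f g) g) := by
    intro g
    have hPf := hP (f g) g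
    by_cases h : ∀ x, P x g ≤ κ * w g
    · have := hgood g h
      have : 0 ≤ 2 * (κ⁻¹ * P (f g) g) := by positivity
      linarith
    · have h₁ : w g ≤ κ⁻¹ * P (f g) g := (le_inv_mul_iff₀ hκ).2 (hf g h)
      have := htriv g
      have := mul_nonneg hη (hw0 g)
      linarith
  calc ∑ g, ∑ y, ∑ z, p y * |∑ x, c y z x * P x g|
      ≤ ∑ g, (η * w g + 2 * (κ⁻¹ * P (f g) g)) := Finset.sum_le_sum fun g _ => hbad g
    _ = η * ∑ g, w g + 2 * (κ⁻¹ * ∑ g, P (f g) g) := by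
        rw [Finset.sum_add_distrib, ← Finset.mul_sum, ← Finset.mul_sum, ← Finset.mul_sum]
    _ ≤ η * 1 + 2 * (κ⁻¹ * (γ * κ)) := by
        gcongr
        exact hguess f
    _ = η + 2 * γ := by field_simp

end Guessing

/-! ### From quantum to classical side information -/

section Pairing

set_option linter.unusedSectionVars false

variable {X Y Z E : Type*} [Fintype X] [DecidableEq X] [Fintype Y] [Fintype Z] [Fintype E]
  [DecidableEq E]

lemma re_trace_mul_sum_smul (T : Matrix E E ℂ) (c : X → ℝ) (r : X → Matrix E E ℂ) :
    (T * ∑ x, c x • r x).trace.re = ∑ x, c x * (T * r x).trace.re := by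
  simp only [Finset.mul_sum, Matrix.mul_smul, Matrix.trace_sum, Matrix.trace_smul, Complex.re_sum,
    Complex.smul_re, smul_eq_mul]

/-- The pretty good measurement bounds the quadratic form `Tr(Δ S⁻¹ Δ S⁻¹)` of a signed mixture by
the performance of a classical observer. -/
lemma re_trace_sum_smul_conj_le (c : X → ℝ) (hc : ∀ x, |c x| ≤ 1) (r : X → Matrix E E ℂ)
    (N : Matrix E E ℂ) :
    ((∑ x, c x • r x) * N * (∑ x, c x • r x) * N).trace.re
      ≤ ∑ x', |∑ x, c x * (r x * (N * r x' * N)).trace.re| := by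
  have h : ((∑ x, c x • r x) * N * (∑ x, c x • r x) * N).trace.re
      = ∑ x', c x' * ∑ x, c x * (r x * (N * r x' * N)).trace.re := by
    simp only [Finset.mul_sum, Finset.sum_mul, Matrix.smul_mul, Matrix.mul_smul, Matrix.trace_sum,
      Matrix.trace_smul, Complex.re_sum, Complex.smul_re, smul_eq_mul, Matrix.mul_assoc]
  rw [h]
  refine Finset.sum_le_sum fun x' _ => (le_abs_self _).trans ?_
  rw [abs_mul]
  exact mul_le_of_le_one_left (abs_nonneg _) (hc x')

/-- Quantum side information about a source, against a classical extractor with a weak seed of law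
`p`, in dual form: `T y z` is the test applied on seed `y` and output `z`. -/
lemma sum_re_trace_le_of_guessing (p : Y → ℝ) (c : Y → Z → X → ℝ) {κ ε : ℝ} (hκ : 0 < κ)
    (hε : 0 < ε) [Nonempty Z] (hp : ∀ y, 0 ≤ p y) (hp1 : ∑ y, p y = 1)
    (hc : ∀ y x, ∑ z, |c y z x| ≤ 2) (hc1 : ∀ y z x, |c y z x| ≤ 1)
    (hflat : ∀ q ∈ stdSimplex ℝ X, (∀ x, q x ≤ κ) → ∑ y, ∑ z, p y * |∑ x, c y z x * q x| ≤ 2 * ε)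
    (r : X → Matrix E E ℂ) (hr : ∀ x, (r x).PosSemidef) (hr1 : (∑ x, r x).trace.re = 1)
    (hguess : ∀ M : X → Matrix E E ℂ, (∀ x, (M x).PosSemidef) → (1 - ∑ x, M x).PosSemidef →
      ∀ f : X → X, ∑ x, (r (f x) * M x).trace.re ≤ ε * κ)
    (T : Y → Z → Matrix E E ℂ) (hT : ∀ y z, IsContraction (T y z)) :
    ∑ y, ∑ z, p y * ∑ x, c y z x * (T y z * r x).trace.re
      ≤ 2 * √(Fintype.card Z * ε) := by
  set n : ℝ := (Fintype.card Z : ℝ) with hn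
  have hn0 : 0 < n := by rw [hn]; exact_mod_cast Fintype.card_pos
  set a := √(n * ε) with ha
  have ha0 : 0 < a := Real.sqrt_pos.2 (mul_pos hn0 hε)
  have haa : a * a = n * ε := Real.mul_self_sqrt (mul_pos hn0 hε).le
  set ρ := ∑ x, r x with hρdef
  have hρ : ρ.PosSemidef := Matrix.posSemidef_sum _ fun x _ => hr x
  -- The state `ρ` may be singular; adding `δ` makes it invertible at a cost that vanishes with `δ`.
  have key : ∀ δ : ℝ, 0 < δ →
      ∑ y, ∑ z, p y * ∑ x, c y z x * (T y z * r x).trace.re ≤ 2 * a + δ * (Fintype.card E * a) := by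
    intro δ hδ
    have hσ : (ρ + (δ : ℂ) • (1 : Matrix E E ℂ)).PosDef := by
      refine Matrix.PosDef.posSemidef_add hρ (Matrix.PosDef.one.smul ?_)
      exact_mod_cast hδ
    obtain ⟨S, hS, hSS⟩ := exists_posDef_mul_self hσ
    have hdet : IsUnit S.det := (Matrix.isUnit_iff_isUnit_det S).1 hS.isUnit
    have hSi : S * S⁻¹ = 1 := Matrix.mul_nonsing_inv S hdet
    have hiS : S⁻¹ * S = 1 := Matrix.nonsing_inv_mul S hdet
    have hSH := hS.inv.1
    have hSS1 : (S * S).trace.re = 1 + δ * Fintype.card E := by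
      rw [hSS, Matrix.trace_add, Matrix.trace_smul, Matrix.trace_one, Complex.add_re, hr1]
      simp
    set M : X → Matrix E E ℂ := fun x => S⁻¹ * r x * S⁻¹ with hM
    have hM0 : ∀ x, (M x).PosSemidef := fun x => by
      have := (hr x).mul_mul_conjTranspose_same S⁻¹
      rwa [hSH.eq] at this
    -- The defect is `δ S⁻¹ S⁻¹`: regularising leaves a sub-normalised measurement.
    have hM1 : (1 - ∑ x, M x).PosSemidef := by
      have h := (Matrix.PosSemidef.one (n := E) (R := ℂ)).smul
        (show (0 : ℂ) ≤ (δ : ℂ) by exact_mod_cast hδ.le)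
      have h := h.mul_mul_conjTranspose_same S⁻¹
      rw [hSH.eq] at h
      convert h using 1
      have : (δ : ℂ) • (1 : Matrix E E ℂ) = S * S - ρ := by rw [hSS]; abel
      rw [this, Matrix.mul_sub, Matrix.sub_mul, ← Matrix.mul_assoc, hiS, Matrix.one_mul, hSi, hρdef,
        Finset.mul_sum, Finset.sum_mul]
    set P : X → X → ℝ := fun x x' => (r x * M x').trace.re with hPdef
    have hP0 : ∀ x x', 0 ≤ P x x' := fun x x' => re_trace_mul_nonneg (hr x) (hM0 x')
    have hP1 : ∑ x', ∑ x, P x x' ≤ 1 := by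
      have : ∑ x', ∑ x, P x x' = ((∑ x', M x') * ρ).trace.re := by
        rw [Matrix.trace_mul_comm]
        simp only [hPdef, hρdef, Finset.mul_sum, Finset.sum_mul, Matrix.trace_sum, Complex.re_sum]
      rw [this, ← hr1]
      simpa using re_trace_mul_le_of_sub hM1 hρ
    have hobs := sum_abs_le_of_guessing p c hκ (by positivity : 0 ≤ 2 * ε) hε.le hp hp1 hc hflat P
      hP0 hP1 (hguess M hM0 hM1)
    set D : Y → Z → Matrix E E ℂ := fun y z => ∑ x, c y z x • r x with hD
    have hDH : ∀ y z, (D y z).IsHermitian := fun y z => by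
      simp only [hD, Matrix.IsHermitian, Matrix.conjTranspose_sum, Matrix.conjTranspose_smul,
        (hr _).1.eq, star_trivial]
    have hquad : ∑ y, ∑ z, p y * (D y z * S⁻¹ * D y z * S⁻¹).trace.re ≤ 4 * ε := by
      calc ∑ y, ∑ z, p y * (D y z * S⁻¹ * D y z * S⁻¹).trace.re
          ≤ ∑ y, ∑ z, p y * ∑ x', |∑ x, c y z x * P x x'| := by
            gcongr with y _ z _
            · exact hp y
            · exact re_trace_sum_smul_conj_le _ (hc1 y z) r S⁻¹
        _ = ∑ x', ∑ y, ∑ z, p y * |∑ x, c y z x * P x x'| := by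
            simp only [Finset.mul_sum]
            rw [Finset.sum_comm]
            conv_rhs => rw [Finset.sum_comm]
            rw [Finset.sum_comm]
            exact Finset.sum_congr rfl fun y _ => Finset.sum_comm
        _ ≤ 4 * ε := by linarith
    -- The weight `t = 2ε/a` balances the two terms: with `a² = nε`, both `n t` and `t⁻¹ * 4ε` equal
    -- `2a`.
    have ht : 0 < 2 * ε / a := by positivity
    have hcs : ∀ y z, 2 * ∑ x, c y z x * (T y z * r x).trace.re
        ≤ 2 * ε / a * (1 + δ * Fintype.card E)
          + (2 * ε / a)⁻¹ * (D y z * S⁻¹ * D y z * S⁻¹).trace.re := by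
      intro y z
      rw [← re_trace_mul_sum_smul, ← hSS1]
      exact (hT y z).two_mul_re_trace_mul_le (hDH y z) hS ht
    have h2 : 2 * ∑ y, ∑ z, p y * ∑ x, c y z x * (T y z * r x).trace.re
        ≤ n * (2 * ε / a * (1 + δ * Fintype.card E)) + (2 * ε / a)⁻¹ * (4 * ε) := by
      calc 2 * ∑ y, ∑ z, p y * ∑ x, c y z x * (T y z * r x).trace.re
          = ∑ y, ∑ z, p y * (2 * ∑ x, c y z x * (T y z * r x).trace.re) := by
            simp only [Finset.mul_sum, mul_left_comm (2 : ℝ)]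
        _ ≤ ∑ y, ∑ z, p y * (2 * ε / a * (1 + δ * Fintype.card E)
              + (2 * ε / a)⁻¹ * (D y z * S⁻¹ * D y z * S⁻¹).trace.re) := by
            gcongr with y _ z _
            · exact hp y
            · exact hcs y z
        _ = n * (2 * ε / a * (1 + δ * Fintype.card E))
              + (2 * ε / a)⁻¹ * ∑ y, ∑ z, p y * (D y z * S⁻¹ * D y z * S⁻¹).trace.re := by
            simp only [mul_add, Finset.sum_add_distrib, Finset.sum_const, Finset.card_univ,
              nsmul_eq_mul, ← hn]
            congr 1
            · simp only [← Finset.mul_sum, ← Finset.sum_mul, hp1]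
              ring
            · simp only [Finset.mul_sum, mul_left_comm ((2 * ε / a)⁻¹)]
        _ ≤ _ := by gcongr
    have e₁ : n * (2 * ε / a * (1 + δ * Fintype.card E)) = 2 * a * (1 + δ * Fintype.card E) := by
      have : n * (2 * ε / a) = 2 * a := by
        rw [mul_div_assoc', div_eq_iff ha0.ne']; linarith
      rw [← mul_assoc, this]
    have e₂ : (2 * ε / a)⁻¹ * (4 * ε) = 2 * a := by field_simp; norm_num
    rw [e₁, e₂] at h2
    linarith
  have hB : (0 : ℝ) ≤ Fintype.card E * a := by positivity
  refine le_of_forall_pos_le_add fun η hη =>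
    (key (η / (Fintype.card E * a + 1)) (by positivity)).trans ?_
  gcongr
  rw [div_mul_eq_mul_div, div_le_iff₀ (by positivity)]
  nlinarith

end Pairing

/-! ### Block-diagonal states, distances and entropies -/

section Blocks

set_option linter.unusedSectionVars false

variable {X Y W A E : Type} [Fintype X] [DecidableEq X] [Fintype Y] [DecidableEq Y]
  [Fintype W] [DecidableEq W] [Fintype A] [DecidableEq A] [Fintype E] [DecidableEq E]

lemma block_sum_single_kronecker (f : X → Y) (B : X → Matrix E E ℂ) (y : Y) :
    block (∑ x, Matrix.single (f x) (f x) (1 : ℂ) ⊗ₖ B x) y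
      = ∑ x, if f x = y then B x else 0 := by
  ext e e'
  simp only [block, Matrix.of_apply, Matrix.sum_apply, Matrix.kroneckerMap_apply]
  refine Finset.sum_congr rfl fun x _ => ?_
  by_cases h : f x = y <;> simp [h]

/-- A test on a classical-quantum state acts only through its diagonal blocks, so it amounts to one
test per classical value. -/
lemma trace_mul_sum_single_kronecker (f : X → Y) (B : X → Matrix E E ℂ)
    (T : Matrix (Y × E) (Y × E) ℂ) :
    (T * ∑ x, Matrix.single (f x) (f x) (1 : ℂ) ⊗ₖ B x).trace
      = ∑ x, (block T (f x) * B x).trace := by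
  rw [Finset.mul_sum, Matrix.trace_sum]
  refine Finset.sum_congr rfl fun x _ => ?_
  simp only [Matrix.trace, Matrix.diag_apply, Matrix.mul_apply, Matrix.kroneckerMap_apply,
    Fintype.sum_prod_type, block, Matrix.of_apply, Matrix.single_apply]
  rw [Finset.sum_eq_single (f x)]
  · refine Finset.sum_congr rfl fun e _ => ?_
    rw [Finset.sum_eq_single (f x)]
    · simp
    · intro y _ hy
      simp [hy.symm]
    · simp
  · intro y _ hy
    simp [hy.symm]
  · simp

lemma isHermitian_sum_single_kronecker (f : X → Y) (B : X → Matrix E E ℂ)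
    (hB : ∀ x, (B x).IsHermitian) :
    (∑ x, Matrix.single (f x) (f x) (1 : ℂ) ⊗ₖ B x).IsHermitian := by
  simp only [Matrix.IsHermitian, Matrix.conjTranspose_sum, Matrix.conjTranspose_kronecker,
    Matrix.conjTranspose_single, star_one, (hB _).eq]

lemma IsContraction.block {T : Matrix (X × E) (X × E) ℂ} (hT : IsContraction T) (x : X) :
    IsContraction (block T x) :=
  hT.submatrix (f := fun e => (x, e)) fun _ _ h => (Prod.mk.inj h).2

/-- Deviation of the indicator of `ext x = z` from the uniform weight. -/
noncomputable def deviation {m : ℕ} (ext : X → Bits m) (x : X) (z : Bits m) : ℝ :=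
  (if ext x = z then 1 else 0) - (1 / 2) ^ m

lemma abs_deviation_le {m : ℕ} (ext : X → Bits m) (x : X) (z : Bits m) :
    |deviation ext x z| ≤ 1 := by
  have h₀ : (0 : ℝ) ≤ (1 / 2) ^ m := by positivity
  have h₁ : ((1 : ℝ) / 2) ^ m ≤ 1 := pow_le_one₀ (by norm_num) (by norm_num)
  rw [deviation, abs_le]
  split_ifs <;> constructor <;> linarith

lemma sum_abs_deviation_le {m : ℕ} (ext : X → Bits m) (x : X) :
    ∑ z, |deviation ext x z| ≤ 2 := by
  have h₀ : (0 : ℝ) ≤ (1 / 2) ^ m := by positivity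
  calc ∑ z, |deviation ext x z| ≤ ∑ z, ((if ext x = z then (1 : ℝ) else 0) + (1 / 2) ^ m) := by
        refine Finset.sum_le_sum fun z _ => ?_
        rw [deviation, abs_le]
        split_ifs <;> constructor <;> linarith
    _ = 2 := by
        rw [Finset.sum_add_distrib, Finset.sum_ite_eq]
        simp
        norm_num

/-- It suffices to bound the advantage of every test `T`, applied to the output, to `g(X)` and to
the side information. -/
lemma quantumDist_le {m : ℕ} (ext : X → Bits m) (g : X → W) (ρ : Matrix (X × E) (X × E) ℂ)
    (hρ : ∀ x, (block ρ x).IsHermitian) {B : ℝ}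
    (h : ∀ T : Bits m → W → Matrix E E ℂ, (∀ z w, IsContraction (T z w)) →
      ∑ x, ∑ z, deviation ext x z * (T z (g x) * block ρ x).trace.re ≤ 2 * B) :
    quantumDist ext g ρ ≤ B := by
  -- The ideal state is the uniform mixture over `z` of the states with output register set to `z`,
  -- so real and ideal states are both built from `applyFun`.
  have hU : Matrix.reindex (Equiv.prodAssoc (Bits m) W E).symm (Equiv.prodAssoc (Bits m) W E).symm
      (classicalState (fun _ : Bits m => (1 / 2 : ℝ) ^ m) ⊗ₖ applyFun g ρ)
      = ∑ z, (((1 / 2 : ℝ) ^ m : ℝ) : ℂ) • applyFun (fun x => (z, g x)) ρ := by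
    ext ⟨⟨z, w⟩, e⟩ ⟨⟨z', w'⟩, e'⟩
    simp only [Matrix.reindex_apply, Matrix.submatrix_apply, Equiv.symm_symm,
      Equiv.prodAssoc_apply, Matrix.kroneckerMap_apply, classicalState, Matrix.diagonal_apply,
      Matrix.sum_apply, Matrix.smul_apply, applyFun, smul_eq_mul, Matrix.single_apply,
      Prod.mk.injEq, ← Finset.mul_sum]
    rw [Finset.sum_comm]
    by_cases hz : z = z'
    · subst hz
      rw [if_pos rfl]
      congr 1
      refine Finset.sum_congr rfl fun x _ => ?_
      rw [Finset.sum_eq_single z]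
      · simp
      · intro y _ hy
        simp [hy]
      · simp
    · rw [if_neg hz, zero_mul]
      symm
      rw [Finset.sum_eq_zero, mul_zero]
      intro x _
      refine Finset.sum_eq_zero fun y _ => ?_
      rw [if_neg, zero_mul]
      rintro ⟨⟨rfl, _⟩, ⟨rfl, _⟩⟩
      exact hz rfl
  have hH : ∀ f : X → Bits m × W, (applyFun f ρ).IsHermitian := fun f =>
    isHermitian_sum_single_kronecker f _ hρ
  have hM : (applyFun (fun x => (ext x, g x)) ρ
      - ∑ z, (((1 / 2 : ℝ) ^ m : ℝ) : ℂ) • applyFun (fun x => (z, g x)) ρ).IsHermitian := by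
    refine (hH _).sub ?_
    simp only [Matrix.IsHermitian, Matrix.conjTranspose_sum, Matrix.conjTranspose_smul, (hH _).eq,
      Complex.star_def, Complex.conj_ofReal]
  obtain ⟨T, hT, hTM⟩ := exists_traceNorm_eq hM
  have hB := h (fun z w => block T (z, w)) fun z w => hT.block _
  rw [quantumDist, traceDist, hU, hTM, Matrix.mul_sub, Finset.mul_sum, Matrix.trace_sub,
    Matrix.trace_sum]
  have hap : ∀ f : X → Bits m × W, (T * applyFun f ρ).trace
      = ∑ x, (block T (f x) * block ρ x).trace := fun f => trace_mul_sum_single_kronecker f _ T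
  simp only [Matrix.mul_smul, Matrix.trace_smul, hap, Complex.sub_re, Complex.re_sum, smul_eq_mul,
    Complex.re_ofReal_mul]
  have e : ∑ x, ∑ z, deviation ext x z * (block T (z, g x) * block ρ x).trace.re
      = ∑ x, (block T (ext x, g x) * block ρ x).trace.re
        - ∑ z, (1 / 2) ^ m * ∑ x, (block T (z, g x) * block ρ x).trace.re := by
    simp only [deviation, sub_mul, Finset.sum_sub_distrib, ite_mul, one_mul, zero_mul,
      Finset.sum_ite_eq, Finset.mem_univ, if_true, Finset.mul_sum]
    congr 1
    exact Finset.sum_comm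
  rw [e] at hB
  linarith

/-- Serves the regime `ε > 1`, where the claimed error is trivial. -/
lemma quantumDist_le_one {m : ℕ} (ext : X → Bits m) (g : X → W) (ρ : Matrix (X × E) (X × E) ℂ)
    (hρ : ∀ x, (block ρ x).PosSemidef) (hρ1 : ∑ x, (block ρ x).trace.re = 1) :
    quantumDist ext g ρ ≤ 1 := by
  refine quantumDist_le ext g ρ (fun x => (hρ x).1) fun T hT => ?_
  calc ∑ x, ∑ z, deviation ext x z * (T z (g x) * block ρ x).trace.re
      ≤ ∑ x, ∑ z, |deviation ext x z| * (block ρ x).trace.re := by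
        refine Finset.sum_le_sum fun x _ => Finset.sum_le_sum fun z _ => (le_abs_self _).trans ?_
        rw [abs_mul]
        exact mul_le_mul_of_nonneg_left ((hT z (g x)).abs_re_trace_mul_le (hρ x)) (abs_nonneg _)
    _ ≤ ∑ x, 2 * (block ρ x).trace.re := by
        refine Finset.sum_le_sum fun x _ => ?_
        rw [← Finset.sum_mul]
        exact mul_le_mul_of_nonneg_right (sum_abs_deviation_le ext x) (re_trace_nonneg (hρ x))
    _ = 2 * 1 := by rw [← Finset.mul_sum, hρ1]

lemma classicalDist_eq {m : ℕ} (ext : X → Bits m) (g : X → W) (p : X → ℝ) :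
    classicalDist ext g p
      = (1 / 2) * ∑ z, ∑ w, |∑ x, if g x = w then deviation ext x z * p x else 0| := by
  rw [classicalDist, statDist, Fintype.sum_prod_type]
  congr 1
  refine Finset.sum_congr rfl fun z _ => Finset.sum_congr rfl fun w _ => ?_
  congr 1
  rw [pushLaw, prodLaw, pushLaw, Finset.mul_sum, ← Finset.sum_sub_distrib]
  refine Finset.sum_congr rfl fun x _ => ?_
  by_cases h₁ : ext x = z <;> by_cases h₂ : g x = w <;> simp [h₁, h₂, deviation, sub_mul]

/-- Since the seed is observed, absolute values are taken seed by seed and the seed's weight factors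
out. -/
lemma two_mul_classicalDist_fst {m : ℕ} (ext : Y × X → Bits m) {p : Y → ℝ} (hp : ∀ y, 0 ≤ p y)
    (q : X → ℝ) :
    2 * classicalDist ext Prod.fst (prodLaw p q)
      = ∑ y, ∑ z, p y * |∑ x, deviation ext (y, x) z * q x| := by
  rw [classicalDist_eq, ← mul_assoc, Finset.sum_comm]
  norm_num
  refine Finset.sum_congr rfl fun y _ => Finset.sum_congr rfl fun z _ => ?_
  rw [← abs_of_nonneg (hp y), ← abs_mul, Fintype.sum_prod_type,
    Finset.sum_eq_single y]
  · rw [Finset.mul_sum]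
    congr 1
    refine Finset.sum_congr rfl fun x _ => ?_
    simp only [if_true, prodLaw]
    ring
  · intro y' _ hy
    simp [hy]
  · simp

lemma two_mul_classicalDist_snd {m : ℕ} (ext : X × Y → Bits m) {p : Y → ℝ} (hp : ∀ y, 0 ≤ p y)
    (q : X → ℝ) :
    2 * classicalDist ext Prod.snd (prodLaw q p)
      = ∑ y, ∑ z, p y * |∑ x, deviation ext (x, y) z * q x| := by
  rw [classicalDist_eq, ← mul_assoc, Finset.sum_comm]
  norm_num
  refine Finset.sum_congr rfl fun y _ => Finset.sum_congr rfl fun z _ => ?_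
  rw [← abs_of_nonneg (hp y), ← abs_mul, Fintype.sum_prod_type_right,
    Finset.sum_eq_single y]
  · rw [Finset.mul_sum]
    congr 1
    refine Finset.sum_congr rfl fun x _ => ?_
    simp only [if_true, prodLaw]
    ring
  · intro y' _ hy
    simp [hy]
  · simp

lemma le_minEntropy {p : X → ℝ} (hp : p ∈ stdSimplex ℝ X) {k : ℝ}
    (h : ∀ x, p x ≤ (2 : ℝ) ^ (-k)) : k ≤ minEntropy p := by
  -- Total mass one rules out an empty support, where the real infimum would default to `0`.
  have : Nonempty {x : X // p x ≠ 0} := by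
    by_contra hne
    have : ∀ x, p x = 0 := fun x => by_contra fun hx => hne ⟨⟨x, hx⟩⟩
    simpa [this] using hp.2
  refine le_ciInf fun x => ?_
  have hx : 0 < p x.1 := lt_of_le_of_ne (hp.1 x.1) x.2.symm
  rw [Real.le_logb_iff_rpow_le one_lt_two (by positivity), le_div_iff₀ hx]
  calc (2 : ℝ) ^ k * p x.1 ≤ 2 ^ k * 2 ^ (-k) := by gcongr; exact h x.1
    _ = 1 := by rw [← Real.rpow_add two_pos, add_neg_cancel, Real.rpow_zero]

/-- Operational meaning of the conditional min-entropy: it bounds the probability of guessing. -/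
lemma guessing_le_of_le_condMinEntropy (ρ : Matrix (X × E) (X × E) ℂ)
    (hρ : ∀ x, (block ρ x).PosSemidef) (hρ1 : (∑ x, block ρ x).trace.re = 1) {k : ℝ}
    (hk : k ≤ condMinEntropy ρ) {G : Type*} [Fintype G] (M : G → Matrix E E ℂ)
    (hM : ∀ g, (M g).PosSemidef) (hM1 : (1 - ∑ g, M g).PosSemidef) (f : G → X) :
    ∑ g, (block ρ (f g) * M g).trace.re ≤ (2 : ℝ) ^ (-k) := by
  have hbound : ∀ (a : ℝ) (σ : Matrix E E ℂ), 0 ≤ a → σ.PosSemidef → σ.trace.re = 1 →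
      (∀ x, (a • σ - block ρ x).PosSemidef) → ∑ g, (block ρ (f g) * M g).trace.re ≤ a := by
    intro a σ ha hσ hσ1 h
    calc ∑ g, (block ρ (f g) * M g).trace.re ≤ ∑ g, (a • σ * M g).trace.re :=
          Finset.sum_le_sum fun g _ => re_trace_mul_le_of_sub (h (f g)) (hM g)
      _ = a * ((∑ g, M g) * σ).trace.re := by
          rw [Matrix.trace_mul_comm]
          simp only [Matrix.smul_mul, Matrix.trace_smul, Complex.smul_re, smul_eq_mul,
            Finset.mul_sum, Matrix.trace_sum, Complex.re_sum]
      _ ≤ a * (1 * σ).trace.re :=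
          mul_le_mul_of_nonneg_left (re_trace_mul_le_of_sub hM1 hσ) ha
      _ = a := by rw [Matrix.one_mul, hσ1, mul_one]
  -- The choice `σ = ρ_E`, `a = 1` is always feasible and settles `k ≤ 0`.
  have hone : ∑ g, (block ρ (f g) * M g).trace.re ≤ 1 := by
    refine hbound 1 (∑ x, block ρ x) zero_le_one (Matrix.posSemidef_sum _ fun x _ => hρ x) hρ1
      fun x => ?_
    rw [one_smul, ← Finset.sum_erase_eq_sub (Finset.mem_univ x)]
    exact Matrix.posSemidef_sum _ fun x _ => hρ x
  rcases le_or_gt k 0 with h0 | h0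
  · exact hone.trans (Real.one_le_rpow one_le_two (by linarith))
  by_contra! hlt
  set v := ∑ g, (block ρ (f g) * M g).trace.re with hv
  have hv0 : 0 < v := (Real.rpow_pos_of_pos two_pos _).trans hlt
  have hlog : -Real.logb 2 v < k := by
    have := (Real.lt_logb_iff_rpow_lt one_lt_two hv0).2 hlt
    linarith
  -- An empty set has supremum `0` by default, excluded by `k > 0`. The supremum need not be
  -- attained: one feasible `lam` above `-log v` gives the contradiction.
  have hne : {lam : ℝ | 0 ≤ lam ∧ ∃ σ : Matrix E E ℂ, IsDensity σ ∧
      (((2 : ℝ) ^ (-lam)) • ((1 : Matrix X X ℂ) ⊗ₖ σ) - ρ).PosSemidef}.Nonempty := by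
    by_contra hemp
    rw [Set.not_nonempty_iff_eq_empty] at hemp
    rw [condMinEntropy, hemp, Real.sSup_empty] at hk
    linarith
  obtain ⟨lam, ⟨-, σ, hσ, hσρ⟩, hlam⟩ := exists_lt_of_lt_csSup hne (hlog.trans_le hk)
  have hle : v ≤ (2 : ℝ) ^ (-lam) := by
    refine hbound _ σ (Real.rpow_nonneg two_pos.le _) hσ.1 (by rw [hσ.2, Complex.one_re])
      fun x => ?_
    have := hσρ.submatrix fun e : E => (x, e)
    convert this using 1
    ext e e'
    simp [block, Matrix.kroneckerMap_apply]
  have : v < v := by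
    calc v ≤ (2 : ℝ) ^ (-lam) := hle
      _ < 2 ^ Real.logb 2 v := Real.rpow_lt_rpow_of_exponent_lt one_lt_two (by linarith)
      _ = v := Real.rpow_logb two_pos (by norm_num) hv0
  exact lt_irrefl _ this

lemma IsAdmissible.posSemidef {Φ : Matrix A A ℂ →ₗ[ℂ] Matrix E E ℂ} (hΦ : IsAdmissible Φ)
    {M : Matrix A A ℂ} (hM : M.PosSemidef) : (Φ M).PosSemidef :=
  (hΦ.1 1 (M.submatrix Prod.fst Prod.fst) (hM.submatrix _)).submatrix fun e => (e, 0)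

lemma block_controlled (Φ : X → (Matrix A A ℂ →ₗ[ℂ] Matrix E E ℂ)) (p : X → ℝ)
    (ρ₀ : Matrix A A ℂ) (x : X) :
    block (controlled Φ (classicalState p ⊗ₖ ρ₀)) x = p x • Φ x ρ₀ := by
  have h : ∀ x, block (classicalState p ⊗ₖ ρ₀) x = (p x : ℂ) • ρ₀ := by
    intro x
    ext a b
    simp [block, classicalState, Matrix.kroneckerMap_apply]
  rw [controlled, block_sum_single_kronecker (fun x => x), Finset.sum_ite_eq',
    if_pos (Finset.mem_univ x), h, map_smul]
  exact (RCLike.real_smul_eq_coe_smul (K := ℂ) _ _).symm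

end Blocks

/-! ### The two kinds of leakage -/

section Leakage

set_option linter.unusedSectionVars false

variable {X Y W A E : Type} [Fintype X] [DecidableEq X] [Fintype Y] [DecidableEq Y]
  [Fintype W] [DecidableEq W] [Fintype A] [DecidableEq A] [Fintype E] [DecidableEq E]

/-- Side information computed from the seed `Y` does not help. -/
lemma sum_re_trace_le_of_seed_leak {Z : Type} [Fintype Z] {p : Y → ℝ} (hp : ∀ y, 0 ≤ p y)
    (q : X → ℝ) (c : Y → Z → X → ℝ) {B : ℝ} (hB : ∑ y, ∑ z, p y * |∑ x, c y z x * q x| ≤ B)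
    {τ : Y → Matrix E E ℂ} (hτ : ∀ y, (τ y).PosSemidef) (hτ1 : ∀ y, (τ y).trace.re = 1)
    {T : Y → Z → Matrix E E ℂ} (hT : ∀ y z, IsContraction (T y z)) :
    ∑ y, ∑ z, ∑ x, c y z x * (T y z * ((p y * q x) • τ y)).trace.re ≤ B := by
  refine le_trans (Finset.sum_le_sum fun y _ => Finset.sum_le_sum fun z _ => ?_) hB
  have e : ∑ x, c y z x * (T y z * ((p y * q x) • τ y)).trace.re
      = p y * ((∑ x, c y z x * q x) * (T y z * τ y).trace.re) := by
    rw [Finset.sum_mul, Finset.mul_sum]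
    refine Finset.sum_congr rfl fun x _ => ?_
    rw [Matrix.mul_smul, Matrix.trace_smul, Complex.smul_re, smul_eq_mul]
    ring
  rw [e]
  refine mul_le_mul_of_nonneg_left ((le_abs_self _).trans ?_) (hp y)
  rw [abs_mul]
  exact mul_le_of_le_one_right (abs_nonneg _)
    (((hT y z).abs_re_trace_mul_le (hτ y)).trans (hτ1 y).le)

/-- Side information computed from the source `X`, when it has enough conditional min-entropy. -/
lemma sum_re_trace_le_of_source_leak {Z : Type} [Fintype Z] [Nonempty Z] {p : Y → ℝ}
    (hp : p ∈ stdSimplex ℝ Y) {q : X → ℝ} (hq : q ∈ stdSimplex ℝ X) (c : Y → Z → X → ℝ)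
    {k ε : ℝ} (hε : 0 < ε) (hc : ∀ y x, ∑ z, |c y z x| ≤ 2) (hc1 : ∀ y z x, |c y z x| ≤ 1)
    (hflat : ∀ q ∈ stdSimplex ℝ X, k ≤ minEntropy q →
      ∑ y, ∑ z, p y * |∑ x, c y z x * q x| ≤ 2 * ε)
    {τ : X → Matrix E E ℂ} (hτ : ∀ x, (τ x).PosSemidef) (hτ1 : ∀ x, (τ x).trace.re = 1)
    {ρ : Matrix (X × E) (X × E) ℂ} (hρ : ∀ x, block ρ x = q x • τ x)
    (hk : k + Real.logb 2 (1 / ε) ≤ condMinEntropy ρ)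
    {T : Y → Z → Matrix E E ℂ} (hT : ∀ y z, IsContraction (T y z)) :
    ∑ y, ∑ z, ∑ x, c y z x * (T y z * ((p y * q x) • τ x)).trace.re
      ≤ 2 * √(Fintype.card Z * ε) := by
  have hr : ∀ x, (block ρ x).PosSemidef := fun x => by
    rw [hρ]
    exact (hτ x).smul (hq.1 x)
  have hr1 : (∑ x, block ρ x).trace.re = 1 := by
    simp only [hρ, Matrix.trace_sum, Complex.re_sum, Matrix.trace_smul, Complex.smul_re, hτ1,
      smul_eq_mul, mul_one, hq.2]
  have hpow : (2 : ℝ) ^ (-(k + Real.logb 2 (1 / ε))) = ε * 2 ^ (-k) := by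
    rw [one_div, Real.logb_inv, neg_add, neg_neg, Real.rpow_add two_pos,
      Real.rpow_logb two_pos (by norm_num) hε, mul_comm]
  have h := sum_re_trace_le_of_guessing p c (Real.rpow_pos_of_pos two_pos (-k)) hε hp.1 hp.2 hc hc1
    (fun q hq hqk => hflat q hq (le_minEntropy hq hqk)) (block ρ) hr hr1
    (fun M hM hM1 f => hpow ▸ guessing_le_of_le_condMinEntropy ρ hr hr1 hk M hM hM1 f) T hT
  refine le_of_eq_of_le ?_ h
  refine Finset.sum_congr rfl fun y _ => Finset.sum_congr rfl fun z _ => ?_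
  rw [Finset.mul_sum]
  refine Finset.sum_congr rfl fun x _ => ?_
  simp only [hρ, Matrix.mul_smul, Matrix.trace_smul, Complex.smul_re, smul_eq_mul]
  ring

/-- Ignoring `E` and always guessing `x` succeeds with probability `q x`, so the guessing bound caps
every `q x`. -/
lemma le_minEntropy_of_le_condMinEntropy {q : X → ℝ} (hq : q ∈ stdSimplex ℝ X)
    {τ : X → Matrix E E ℂ} (hτ : ∀ x, (τ x).PosSemidef) (hτ1 : ∀ x, (τ x).trace.re = 1)
    {ρ : Matrix (X × E) (X × E) ℂ} (hρ : ∀ x, block ρ x = q x • τ x) {k : ℝ}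
    (hk : k ≤ condMinEntropy ρ) : k ≤ minEntropy q := by
  have hr : ∀ x, (block ρ x).PosSemidef := fun x => by
    rw [hρ]
    exact (hτ x).smul (hq.1 x)
  have hr1 : (∑ x, block ρ x).trace.re = 1 := by
    simp only [hρ, Matrix.trace_sum, Complex.re_sum, Matrix.trace_smul, Complex.smul_re, hτ1,
      smul_eq_mul, mul_one, hq.2]
  refine le_minEntropy hq fun x => ?_
  have h := guessing_le_of_le_condMinEntropy ρ hr hr1 hk (fun _ : Unit => (1 : Matrix E E ℂ))
    (fun _ => Matrix.PosSemidef.one) (by simpa using Matrix.PosSemidef.zero) fun _ => x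
  simpa [hρ, hτ1] using h

end Leakage

/-! ### Blocks of the adversary's state and its marginals -/

section States

variable {n₁ n₂ dA dE : ℕ} {p₁ : Bits n₁ → ℝ} {p₂ : Bits n₂ → ℝ}
  {ρ₀ : Matrix (Fin dA) (Fin dA) ℂ}

lemma block_sideInfoState
    (Φ : Bits n₁ × Bits n₂ → (Matrix (Fin dA) (Fin dA) ℂ →ₗ[ℂ] Matrix (Fin dE) (Fin dE) ℂ))
    (x : Bits n₁ × Bits n₂) :
    block (sideInfoState p₁ p₂ ρ₀ Φ) x = (p₁ x.1 * p₂ x.2) • Φ x ρ₀ :=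
  block_controlled Φ _ ρ₀ x

lemma block_applyFun_fst_sideInfoState (hp₂ : p₂ ∈ stdSimplex ℝ (Bits n₂))
    (Φ : Bits n₁ → (Matrix (Fin dA) (Fin dA) ℂ →ₗ[ℂ] Matrix (Fin dE) (Fin dE) ℂ)) (y : Bits n₁) :
    block (applyFun Prod.fst (sideInfoState p₁ p₂ ρ₀ fun x => Φ x.1)) y = p₁ y • Φ y ρ₀ := by
  rw [applyFun, block_sum_single_kronecker, Fintype.sum_prod_type, Finset.sum_eq_single y]
  · simp only [if_true, block_sideInfoState, ← Finset.sum_smul, ← Finset.mul_sum, hp₂.2, mul_one]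
  · intro y' _ hy
    simp [hy]
  · simp

lemma block_applyFun_snd_sideInfoState (hp₁ : p₁ ∈ stdSimplex ℝ (Bits n₁))
    (Φ : Bits n₂ → (Matrix (Fin dA) (Fin dA) ℂ →ₗ[ℂ] Matrix (Fin dE) (Fin dE) ℂ)) (y : Bits n₂) :
    block (applyFun Prod.snd (sideInfoState p₁ p₂ ρ₀ fun x => Φ x.2)) y = p₂ y • Φ y ρ₀ := by
  rw [applyFun, block_sum_single_kronecker, Fintype.sum_prod_type_right, Finset.sum_eq_single y]
  · simp only [if_true, block_sideInfoState, ← Finset.sum_smul, ← Finset.sum_mul, hp₁.2, one_mul]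
  · intro y' _ hy
    simp [hy]
  · simp

lemma IsAdmissible.re_trace_eq_one
    {Φ : Matrix (Fin dA) (Fin dA) ℂ →ₗ[ℂ] Matrix (Fin dE) (Fin dE) ℂ} (hΦ : IsAdmissible Φ)
    (hρ₀ : IsDensity ρ₀) : (Φ ρ₀).trace.re = 1 := by
  rw [hΦ.2, hρ₀.2, Complex.one_re]

lemma quantumDist_sideInfoState_le_one {m : ℕ} {W : Type} [Fintype W] [DecidableEq W]
    (ext : Bits n₁ × Bits n₂ → Bits m) (g : Bits n₁ × Bits n₂ → W)
    (hp₁ : p₁ ∈ stdSimplex ℝ (Bits n₁)) (hp₂ : p₂ ∈ stdSimplex ℝ (Bits n₂)) (hρ₀ : IsDensity ρ₀)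
    {Φ : Bits n₁ × Bits n₂ → (Matrix (Fin dA) (Fin dA) ℂ →ₗ[ℂ] Matrix (Fin dE) (Fin dE) ℂ)}
    (hΦ : ∀ x, IsAdmissible (Φ x)) :
    quantumDist ext g (sideInfoState p₁ p₂ ρ₀ Φ) ≤ 1 := by
  refine quantumDist_le_one ext g _ (fun x => ?_) ?_
  · rw [block_sideInfoState]
    exact ((hΦ x).posSemidef hρ₀.1).smul (mul_nonneg (hp₁.1 _) (hp₂.1 _))
  · simp only [block_sideInfoState, Matrix.trace_smul, Complex.smul_re,
      (hΦ _).re_trace_eq_one hρ₀, smul_eq_mul, mul_one, Fintype.sum_prod_type, ← Finset.mul_sum,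
      hp₂.2, hp₁.2]

end States

/-! ### Assembling the security statements -/

section Extractors

variable {n₁ n₂ m : ℕ} {ext : Bits n₁ × Bits n₂ → Bits m} {k₁ k₂ ε : ℝ}

lemma sqrt_card_bits_mul_le (m : ℕ) (ε : ℝ) :
    √(Fintype.card (Bits m) * ε) ≤ 2 ^ m * √ε := by
  have h : (1 : ℝ) ≤ 2 ^ m := one_le_pow₀ one_le_two
  simp only [Fintype.card_fun, Fintype.card_bool, Fintype.card_fin, Nat.cast_pow, Nat.cast_ofNat]
  rw [Real.sqrt_mul (by positivity)]
  refine mul_le_mul_of_nonneg_right ?_ (Real.sqrt_nonneg _)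
  rw [Real.sqrt_le_left (by positivity)]
  nlinarith

/-- Used with `a = 1` when `ε > 1`, and with `a = ε` for seed leakage when `ε ≤ 1`. -/
lemma le_two_pow_mul_sqrt (m : ℕ) {a ε : ℝ} (ha : 0 ≤ a) (haε : a ≤ ε) (ha1 : a ≤ 1) :
    a ≤ 2 ^ m * √ε := by
  have h : (1 : ℝ) ≤ 2 ^ m := one_le_pow₀ one_le_two
  have h' : a ≤ √ε := Real.le_sqrt_of_sq_le (by nlinarith)
  nlinarith [Real.sqrt_nonneg ε]

lemma OASecure.of_one_lt {W : Type} [Fintype W] [DecidableEq W] (g : Bits n₁ × Bits n₂ → W)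
    (hε : 1 < ε) : OASecure ext g k₁ k₂ (2 ^ m * √ε) :=
  have h := le_two_pow_mul_sqrt m zero_le_one hε.le le_rfl
  ⟨fun _ hp₁ _ hp₂ _ _ _ _ hρ₀ hΦ _ _ =>
    (quantumDist_sideInfoState_le_one ext g hp₁ hp₂ hρ₀ fun x => hΦ x.1).trans h,
  fun _ hp₁ _ hp₂ _ _ _ _ hρ₀ hΦ _ _ =>
    (quantumDist_sideInfoState_le_one ext g hp₁ hp₂ hρ₀ fun x => hΦ x.2).trans h⟩

lemma OASecure.mono {W : Type} [Fintype W] [DecidableEq W] {g : Bits n₁ × Bits n₂ → W}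
    {k₁' k₂' : ℝ} (h : OASecure ext g k₁ k₂ ε) (h₁ : k₁ ≤ k₁') (h₂ : k₂ ≤ k₂') :
    OASecure ext g k₁' k₂' ε :=
  ⟨fun p₁ hp₁ p₂ hp₂ dA dE ρ₀ Φ hρ₀ hΦ hk₁ hk₂ =>
    h.1 p₁ hp₁ p₂ hp₂ dA dE ρ₀ Φ hρ₀ hΦ (h₁.trans hk₁) (h₂.trans hk₂),
  fun p₁ hp₁ p₂ hp₂ dA dE ρ₀ Φ hρ₀ hΦ hk₁ hk₂ =>
    h.2 p₁ hp₁ p₂ hp₂ dA dE ρ₀ Φ hρ₀ hΦ (h₁.trans hk₁) (h₂.trans hk₂)⟩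

lemma logb_one_div_nonneg (hε : 0 < ε) (hε1 : ε ≤ 1) : 0 ≤ Real.logb 2 (1 / ε) :=
  Real.logb_nonneg one_lt_two ((one_le_div hε).2 hε1)

/-- The map `f` is what is revealed of the seed: a constant gives plain security, the identity
strong security. A test seeing only `f y` is a special case of one seeing `y`. -/
lemma ClassicalSecure.oaSecure_fst {W : Type} [Fintype W] [DecidableEq W]
    (h : ClassicalSecure ext Prod.fst k₁ k₂ ε) (hε : 0 < ε) (f : Bits n₁ → W) :
    OASecure ext (fun x => f x.1) k₁ (k₂ + Real.logb 2 (1 / ε)) (2 ^ m * √ε) := by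
  rcases lt_or_ge 1 ε with hε1 | hε1
  · exact OASecure.of_one_lt _ hε1
  have hlog := logb_one_div_nonneg hε hε1
  have hstrong : ∀ p₁ ∈ stdSimplex ℝ (Bits n₁), k₁ ≤ minEntropy p₁ →
      ∀ p₂ ∈ stdSimplex ℝ (Bits n₂), k₂ ≤ minEntropy p₂ →
        ∑ y, ∑ z, p₁ y * |∑ x, deviation ext (y, x) z * p₂ x| ≤ 2 * ε := by
    intro p₁ hp₁ hk₁ p₂ hp₂ hk₂
    rw [← two_mul_classicalDist_fst ext hp₁.1]
    exact mul_le_mul_of_nonneg_left (h p₁ hp₁ p₂ hp₂ hk₁ hk₂) zero_le_two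
  refine ⟨fun p₁ hp₁ p₂ hp₂ dA dE ρ₀ Φ hρ₀ hΦ hk₁ hk₂ => ?_,
    fun p₁ hp₁ p₂ hp₂ dA dE ρ₀ Φ hρ₀ hΦ hk₁ hk₂ => ?_⟩
  · have hτ := fun x => (hΦ x).posSemidef hρ₀.1
    have hτ1 := fun x => (hΦ x).re_trace_eq_one hρ₀
    refine (quantumDist_le ext _ _ (fun x => ?_) fun T hT => ?_).trans
      (le_two_pow_mul_sqrt m hε.le le_rfl hε1)
    · rw [block_sideInfoState]
      exact ((hτ _).smul (mul_nonneg (hp₁.1 _) (hp₂.1 _))).1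
    · have hH := le_minEntropy_of_le_condMinEntropy hp₁ hτ hτ1
        (block_applyFun_fst_sideInfoState hp₂ Φ) hk₁
      have := sum_re_trace_le_of_seed_leak hp₁.1 p₂ (fun y z x => deviation ext (y, x) z)
        (hstrong p₁ hp₁ hH p₂ hp₂ (by linarith)) hτ hτ1 fun y z => hT z (f y)
      simp only [block_sideInfoState, Fintype.sum_prod_type]
      refine le_of_eq_of_le (Finset.sum_congr rfl fun y _ => Finset.sum_comm) this
  · have hτ := fun x => (hΦ x).posSemidef hρ₀.1
    have hτ1 := fun x => (hΦ x).re_trace_eq_one hρ₀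
    refine (quantumDist_le ext _ _ (fun x => ?_) fun T hT => ?_).trans (sqrt_card_bits_mul_le m ε)
    · rw [block_sideInfoState]
      exact ((hτ _).smul (mul_nonneg (hp₁.1 _) (hp₂.1 _))).1
    · have := sum_re_trace_le_of_source_leak hp₁ hp₂ (fun y z x => deviation ext (y, x) z) hε
        (fun y x => sum_abs_deviation_le ext (y, x)) (fun y z x => abs_deviation_le ext (y, x) z)
        (hstrong p₁ hp₁ hk₁) hτ hτ1 (block_applyFun_snd_sideInfoState hp₁ Φ) hk₂
        fun y z => hT z (f y)
      simp only [block_sideInfoState, Fintype.sum_prod_type]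
      refine le_of_eq_of_le (Finset.sum_congr rfl fun y _ => Finset.sum_comm) this

lemma ClassicalSecure.oaSecure_snd {W : Type} [Fintype W] [DecidableEq W]
    (h : ClassicalSecure ext Prod.snd k₁ k₂ ε) (hε : 0 < ε) (f : Bits n₂ → W) :
    OASecure ext (fun x => f x.2) (k₁ + Real.logb 2 (1 / ε)) k₂ (2 ^ m * √ε) := by
  rcases lt_or_ge 1 ε with hε1 | hε1
  · exact OASecure.of_one_lt _ hε1
  have hlog := logb_one_div_nonneg hε hε1
  have hstrong : ∀ p₂ ∈ stdSimplex ℝ (Bits n₂), k₂ ≤ minEntropy p₂ →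
      ∀ p₁ ∈ stdSimplex ℝ (Bits n₁), k₁ ≤ minEntropy p₁ →
        ∑ y, ∑ z, p₂ y * |∑ x, deviation ext (x, y) z * p₁ x| ≤ 2 * ε := by
    intro p₂ hp₂ hk₂ p₁ hp₁ hk₁
    rw [← two_mul_classicalDist_snd ext hp₂.1]
    exact mul_le_mul_of_nonneg_left (h p₁ hp₁ p₂ hp₂ hk₁ hk₂) zero_le_two
  refine ⟨fun p₁ hp₁ p₂ hp₂ dA dE ρ₀ Φ hρ₀ hΦ hk₁ hk₂ => ?_,
    fun p₁ hp₁ p₂ hp₂ dA dE ρ₀ Φ hρ₀ hΦ hk₁ hk₂ => ?_⟩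
  · have hτ := fun x => (hΦ x).posSemidef hρ₀.1
    have hτ1 := fun x => (hΦ x).re_trace_eq_one hρ₀
    refine (quantumDist_le ext _ _ (fun x => ?_) fun T hT => ?_).trans (sqrt_card_bits_mul_le m ε)
    · rw [block_sideInfoState]
      exact ((hτ _).smul (mul_nonneg (hp₁.1 _) (hp₂.1 _))).1
    · have := sum_re_trace_le_of_source_leak hp₂ hp₁ (fun y z x => deviation ext (x, y) z) hε
        (fun y x => sum_abs_deviation_le ext (x, y)) (fun y z x => abs_deviation_le ext (x, y) z)
        (hstrong p₂ hp₂ hk₂) hτ hτ1 (block_applyFun_fst_sideInfoState hp₂ Φ) hk₁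
        fun y z => hT z (f y)
      simp only [block_sideInfoState, Fintype.sum_prod_type_right, mul_comm (p₁ _)]
      refine le_of_eq_of_le (Finset.sum_congr rfl fun y _ => Finset.sum_comm) this
  · have hτ := fun x => (hΦ x).posSemidef hρ₀.1
    have hτ1 := fun x => (hΦ x).re_trace_eq_one hρ₀
    refine (quantumDist_le ext _ _ (fun x => ?_) fun T hT => ?_).trans
      (le_two_pow_mul_sqrt m hε.le le_rfl hε1)
    · rw [block_sideInfoState]
      exact ((hτ _).smul (mul_nonneg (hp₁.1 _) (hp₂.1 _))).1
    · have hH := le_minEntropy_of_le_condMinEntropy hp₂ hτ hτ1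
        (block_applyFun_snd_sideInfoState hp₁ Φ) hk₂
      have := sum_re_trace_le_of_seed_leak hp₂.1 p₁ (fun y z x => deviation ext (x, y) z)
        (hstrong p₂ hp₂ hH p₁ hp₁ (by linarith)) hτ hτ1 fun y z => hT z (f y)
      simp only [block_sideInfoState, Fintype.sum_prod_type_right, mul_comm (p₁ _)]
      refine le_of_eq_of_le (Finset.sum_congr rfl fun y _ => Finset.sum_comm) this

lemma IsX1StrongTwoSourceExtractor.isOAX1Strong (h : IsX1StrongTwoSourceExtractor ext k₁ k₂ ε)
    (hε : 0 < ε) :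
    IsOAX1StrongTwoSourceExtractor ext k₁ (k₂ + Real.logb 2 (1 / ε)) (2 ^ m * √ε) :=
  ⟨h.2.oaSecure_fst hε fun _ => (), h.2.oaSecure_fst hε fun x => x⟩

lemma IsX2StrongTwoSourceExtractor.isOAX2Strong (h : IsX2StrongTwoSourceExtractor ext k₁ k₂ ε)
    (hε : 0 < ε) :
    IsOAX2StrongTwoSourceExtractor ext (k₁ + Real.logb 2 (1 / ε)) k₂ (2 ^ m * √ε) :=
  ⟨h.2.oaSecure_snd hε fun _ => (), h.2.oaSecure_snd hε fun x => x⟩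

end Extractors

end QExt
theorem theorem5p3 {n₁ n₂ m : ℕ} (ext : QExt.Bits n₁ × QExt.Bits n₂ → QExt.Bits m)
    (k₁ k₂ ε : ℝ) (hε : 0 < ε) :
    (QExt.IsX1StrongTwoSourceExtractor ext k₁ k₂ ε →
      QExt.IsOAX1StrongTwoSourceExtractor ext k₁ (k₂ + Real.logb 2 (1 / ε)) (2 ^ m * √ε)) ∧
    (QExt.IsX2StrongTwoSourceExtractor ext k₁ k₂ ε →
      QExt.IsOAX2StrongTwoSourceExtractor ext (k₁ + Real.logb 2 (1 / ε)) k₂ (2 ^ m * √ε)) ∧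
    (QExt.IsX1StrongTwoSourceExtractor ext k₁ k₂ ε ∧
        QExt.IsX2StrongTwoSourceExtractor ext k₁ k₂ ε →
      QExt.IsOAX1StrongTwoSourceExtractor ext (k₁ + Real.logb 2 (1 / ε))
          (k₂ + Real.logb 2 (1 / ε)) (2 ^ m * √ε) ∧
        QExt.IsOAX2StrongTwoSourceExtractor ext (k₁ + Real.logb 2 (1 / ε))
          (k₂ + Real.logb 2 (1 / ε)) (2 ^ m * √ε)) := by
  refine ⟨fun h => h.isOAX1Strong hε, fun h => h.isOAX2Strong hε, fun h => ?_⟩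
  -- For `ε > 1` the entropy shift is negative and monotonicity fails, but the error bound exceeds
  -- `1`.
  rcases lt_or_ge 1 ε with hε1 | hε1
  · exact ⟨⟨QExt.OASecure.of_one_lt _ hε1, QExt.OASecure.of_one_lt _ hε1⟩,
      QExt.OASecure.of_one_lt _ hε1, QExt.OASecure.of_one_lt _ hε1⟩
  · have hlog := QExt.logb_one_div_nonneg hε hε1
    have h₁ := h.1.isOAX1Strong hε
    have h₂ := h.2.isOAX2Strong hε
    have hk₁ : k₁ ≤ k₁ + Real.logb 2 (1 / ε) := by linarith
    have hk₂ : k₂ ≤ k₂ + Real.logb 2 (1 / ε) := by linarith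
    exact ⟨⟨h₁.1.mono hk₁ le_rfl, h₁.2.mono hk₁ le_rfl⟩,
      h₂.1.mono le_rfl hk₂, h₂.2.mono le_rfl hk₂⟩
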